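/- A topological group $G$ is called amenable if every continuous action $G\times X\to X$ of $G$ on a nonempty compact Hausdorff space $X$ has an invariant regular Borel probability measure. A Polish group is called non-archimedean if its neutral element has a neighbourhood basis consisting of open subgroups. **Theorem** (the Cantor set is a test space for amenability of non-archimedean Polish groups). Let $G$ be a non-archimedean Polish group. Then $G$ is amenable if and only if every continuous action $G\times D^{\aleph_0}\to D^{\aleph_0}$ of $G$ on the Cantor set $D^{\aleph_0}$ (where $D=\{0,1\}$ is discrete and $D^{\aleph_0}$ has the product topology) has an invariant Borel probability measure. -/

import Mathlib

open MeasureTheory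

/-- The `G`-space `X` carries an invariant probability measure: a (regular) Borel probability
measure `μ` on `X` with `μ (g⁻¹ A) = μ A` for all `g : G` and all Borel sets `A`.
On a compact Hausdorff space the regular Borel probability measures are the positive normalized
elements of the dual of `C(X)`; on a compact metrizable space every Borel probability measure
is regular. -/
def HasInvariantProbabilityMeasure (G X : Type*) [Group G] [TopologicalSpace X]
    [MeasurableSpace X] [BorelSpace X] [MulAction G X] : Prop :=
  ∃ μ : Measure X, IsProbabilityMeasure μ ∧ μ.Regular ∧ SMulInvariantMeasure G X μ

universe u v

/-- A topological group `G` is amenable if every (jointly) continuous action of `G` on a nonempty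
compact Hausdorff space has an invariant Borel probability measure. -/
def IsAmenableTopologicalGroup (G : Type u) [Group G] [TopologicalSpace G] : Prop :=
  ∀ (X : Type v) [TopologicalSpace X] [CompactSpace X] [T2Space X] [Nonempty X]
    [MeasurableSpace X] [BorelSpace X] [MulAction G X] [ContinuousSMul G X],
    HasInvariantProbabilityMeasure G X

/-- The Cantor set `D ^ ℵ₀`: the product of countably many copies of the two-point discrete
space, with the product topology. -/
abbrev CantorSpace : Type := ℕ → Bool

/-!
Only the passage from the Cantor space to an arbitrary compact Hausdorff `G`-space `X` needs an
argument. The group `G` is used through its separability and its open subgroups.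

Fix `x₀ : X` and an entourage `U` of `X`. Since small open subgroups `V` of `G` move all points of
`X` only a little, the orbit map `g ↦ g • x₀` is `U`-close to a function `a : G → X` which has
finitely many values and satisfies `a (v * g) = a g` for `v ∈ V`. The closure of the set of right
translates of `a`, with `(g • y) h = y (h * g)`, is a compact totally disconnected space
(`TranslateHull`). Left invariance under `V` makes the action on it continuous, and, with
separability of `G`, makes it metrizable. By Brouwer's theorem (`nonempty_homeomorph_nat_bool`) its
product with a Cantor space is a Cantor space, so the hypothesis gives an invariant measure on it
(`exists_invariant_image_of_cantor`). Let `ν` be the image of this measure under `y ↦ y 1`. Every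
point `y` of the hull agrees on `{1, g}` with a translate of `a`, so `y g` is close to `g • y 1`;
since `y g = (g • y) 1` has the same distribution as `y 1`, the measure `ν` is almost invariant
under each fixed `g` when `U` is small
(`exists_identically_distributed_near_orbit`).

As `U` shrinks to the diagonal, an ultrafilter limit of these measures, taken as functionals on
`C(X, ℝ)` and represented by the Riesz–Markov–Kakutani theorem, is a regular invariant probability
measure (`hasInvariantProbabilityMeasure_of_approx`).
-/

open Filter Topology Set

/-! ### Brouwer's characterization of the Cantor set -/

/-- The cell containing `x` at level `n` of the nested sequence of partitions which starts with the
whole space and cuts every cell `q` of level `n` into `q ∩ S n q` and `q \ S n q`. -/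
def splitCell {K : Type*} (S : ℕ → Set K → Set K) : ℕ → K → Set K
  | 0, _ => univ
  | n + 1, x => {y | y ∈ splitCell S n x ∧
      (y ∈ S n (splitCell S n x) ↔ x ∈ S n (splitCell S n x))}

/-- The address of `x`: its `n`-th digit says on which side of the `n`-th cut `x` lies. -/
noncomputable def splitCode {K : Type*} (S : ℕ → Set K → Set K) (x : K) (n : ℕ) : Bool :=
  open Classical in decide (x ∈ S n (splitCell S n x))

section Split

variable {K : Type*} {S : ℕ → Set K → Set K}

lemma mem_splitCell_self (n : ℕ) (x : K) : x ∈ splitCell S n x := by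
  induction n with
  | zero => trivial
  | succ n ih => exact ⟨ih, Iff.rfl⟩

lemma splitCell_eq_of_mem {n : ℕ} {x y : K} (h : y ∈ splitCell S n x) :
    splitCell S n y = splitCell S n x := by
  induction n with
  | zero => rfl
  | succ n ih =>
    have h' := ih h.1
    ext z
    simp only [splitCell, h', mem_ofPred_eq, h.2]

lemma mem_splitCell_iff {n : ℕ} {x y : K} :
    y ∈ splitCell S n x ↔ ∀ i < n, splitCode S y i = splitCode S x i := by
  induction n with
  | zero => simp [splitCell]
  | succ n ih =>
    rw [Nat.forall_lt_succ_right, ← ih]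
    refine and_congr_right fun h => ?_
    simp [splitCode, splitCell_eq_of_mem h]

/-- If every cut is nontrivial then every address occurs. -/
lemma exists_splitCode_eq [Nonempty K]
    (hcut : ∀ n x, (splitCell S n x ∩ S n (splitCell S n x)).Nonempty ∧
      (splitCell S n x \ S n (splitCell S n x)).Nonempty) (c : ℕ → Bool) (n : ℕ) :
    ∃ x, ∀ i < n, splitCode S x i = c i := by
  induction n with
  | zero => exact ⟨Classical.arbitrary K, by simp⟩
  | succ n ih =>
    obtain ⟨x, hx⟩ := ih
    have key : ∃ y ∈ splitCell S n x, splitCode S y n = c n := by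
      obtain ⟨⟨y, hy, hy'⟩, ⟨z, hz, hz'⟩⟩ := hcut n x
      cases hc : c n
      · exact ⟨z, hz, by simpa [splitCode, splitCell_eq_of_mem hz] using hz'⟩
      · exact ⟨y, hy, by simpa [splitCode, splitCell_eq_of_mem hy] using hy'⟩
    obtain ⟨y, hy, hyn⟩ := key
    refine ⟨y, Nat.forall_lt_succ_right.2 ⟨fun i hi => ?_, hyn⟩⟩
    rw [mem_splitCell_iff.1 hy i hi, hx i hi]

variable [TopologicalSpace K]

lemma isClopen_splitCell (hS : ∀ n q, IsClopen (S n q)) (n : ℕ) (x : K) :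
    IsClopen (splitCell S n x) := by
  induction n with
  | zero => exact isClopen_univ
  | succ n ih =>
    by_cases hx : x ∈ S n (splitCell S n x)
    · have : splitCell S (n + 1) x = splitCell S n x ∩ S n (splitCell S n x) := by
        ext y; simp [splitCell, hx]
      exact this ▸ ih.inter (hS _ _)
    · have : splitCell S (n + 1) x = splitCell S n x \ S n (splitCell S n x) := by
        ext y; simp [splitCell, hx]
      exact this ▸ ih.diff (hS _ _)

lemma continuous_splitCode (hS : ∀ n q, IsClopen (S n q)) : Continuous (splitCode S) := by
  refine continuous_pi fun n => IsLocallyConstant.continuous ?_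
  rw [IsLocallyConstant.iff_eventually_eq]
  intro x
  filter_upwards [(isClopen_splitCell hS (n + 1) x).isOpen.mem_nhds (mem_splitCell_self _ x)]
    with y hy
  exact mem_splitCell_iff.1 hy n n.lt_succ_self

end Split

/-- **Brouwer's theorem**: the Cantor space is, up to homeomorphism, the only nonempty compact
metrizable totally disconnected space without isolated points. -/
theorem nonempty_homeomorph_nat_bool (K : Type*) [TopologicalSpace K] [CompactSpace K] [T2Space K]
    [TotallyDisconnectedSpace K] [SecondCountableTopology K] [PerfectSpace K] [Nonempty K] :
    Nonempty (K ≃ₜ (ℕ → Bool)) := by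
  have : TotallySeparatedSpace K := inferInstance
  have : Countable (TopologicalSpace.Clopens K) :=
    TopologicalSpace.Clopens.countable_iff_secondCountable.2 inferInstance
  obtain ⟨B, hB⟩ := exists_surjective_nat (TopologicalSpace.Clopens K)
  -- The `n`-th cut of a cell is made along the `n`-th clopen set `B n`, unless that cut is trivial.
  have hsplit : ∀ (n : ℕ) (q : Set K), ∃ S, IsClopen S ∧ (IsOpen q → q.Nonempty →
      (q ∩ S).Nonempty ∧ (q \ S).Nonempty ∧ (q ⊆ B n ∨ Disjoint q (B n) ∨ S = B n)) := by
    intro n q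
    by_cases h1 : (q ∩ B n).Nonempty ∧ (q \ B n).Nonempty
    · exact ⟨B n, (B n).isClopen, fun _ _ => ⟨h1.1, h1.2, .inr (.inr rfl)⟩⟩
    · have h2 : q ⊆ B n ∨ Disjoint q (B n) := by
        rw [not_and_or, not_nonempty_iff_eq_empty, not_nonempty_iff_eq_empty,
          ← disjoint_iff_inter_eq_empty, sdiff_eq_empty] at h1
        exact h1.symm
      by_cases h3 : IsOpen q ∧ q.Nonempty
      · obtain ⟨x, hx⟩ := h3.2
        obtain ⟨y, hy, hyx⟩ := preperfect_iff_nhds.1 (PerfectSpace.univ_preperfect (α := K)) x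
          trivial q (h3.1.mem_nhds hx)
        obtain ⟨T, hT, hyT, hxT⟩ := exists_isClopen_of_totally_separated hyx
        exact ⟨T, hT, fun _ _ => ⟨⟨y, hy.1, hyT⟩, ⟨x, hx, hxT⟩, h2.imp_right .inl⟩⟩
      · exact ⟨univ, isClopen_univ, fun ho hn => (h3 ⟨ho, hn⟩).elim⟩
  choose S hS hcut using hsplit
  have hcut' := fun n x => hcut n (splitCell S n x) (isClopen_splitCell hS n x).isOpen
    ⟨x, mem_splitCell_self n x⟩
  have hcont : Continuous (splitCode S) := continuous_splitCode hS
  have hinj : Function.Injective (splitCode S) := by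
    intro x y hxy
    by_contra hne
    obtain ⟨T, hT, hxT, hyT⟩ := exists_isClopen_of_totally_separated hne
    obtain ⟨n, hn⟩ := hB ⟨T, hT⟩
    have hBT : (B n : Set K) = T := by rw [hn]; rfl
    have hy : ∀ m, y ∈ splitCell S m x := fun m => mem_splitCell_iff.2 fun i _ => by rw [hxy]
    have hx : x ∈ splitCell S n x := mem_splitCell_self n x
    rcases (hcut' n x).2.2 with h | h | h
    · exact hyT (hBT ▸ h (hy n))
    · exact disjoint_left.1 h hx (hBT ▸ hxT)
    · exact hyT (hBT ▸ h ▸ (hy (n + 1)).2.2 (h.symm ▸ hBT.symm ▸ hxT))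
  have hsurj : Function.Surjective (splitCode S) := by
    have hdense : DenseRange (splitCode S) := by
      intro c
      choose x hx using exists_splitCode_eq (fun n x => ⟨(hcut' n x).1, (hcut' n x).2.1⟩) c
      refine mem_closure_of_tendsto (f := fun n => splitCode S (x n)) (b := atTop) ?_
        (Eventually.of_forall fun n => mem_range_self _)
      refine tendsto_pi_nhds.2 fun i => tendsto_const_nhds.congr' ?_
      filter_upwards [eventually_gt_atTop i] with n hn
      exact (hx n i hn).symm
    exact range_eq_univ.1 ((isCompact_range hcont).isClosed.closure_eq ▸ hdense.closure_range)
  exact ⟨hcont.homeoOfEquivCompactToT2 (f := Equiv.ofBijective _ ⟨hinj, hsurj⟩)⟩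

/-- A product with the Cantor space has no isolated points. -/
instance perfectSpace_prod_nat_bool (Y : Type*) [TopologicalSpace Y] :
    PerfectSpace (Y × (ℕ → Bool)) := by
  refine ⟨preperfect_iff_nhds.2 fun ⟨y, z⟩ _ U hU => ?_⟩
  have ht : Tendsto (fun n : ℕ => (y, Function.update z n (!z n))) atTop (𝓝 (y, z)) := by
    refine tendsto_const_nhds.prodMk_nhds (tendsto_pi_nhds.2 fun i => ?_)
    refine tendsto_const_nhds.congr' ?_
    filter_upwards [eventually_gt_atTop i] with n hn
    rw [Function.update_of_ne hn.ne]
  obtain ⟨n, hn⟩ := (ht.eventually_mem hU).exists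
  refine ⟨_, ⟨hn, trivial⟩, fun h => ?_⟩
  have := congrFun (congrArg Prod.snd h) n
  simp at this

/-! ### Actions transported to the Cantor space -/

/-- If every continuous action on the Cantor space has an invariant measure, then every compact
metrizable totally disconnected `G`-space `Y` carries an invariant measure, presented here as the
image of a measure `μ` under a continuous map `p`: the product of `Y` and the Cantor space with
trivial action is a Cantor space. -/
lemma exists_invariant_image_of_cantor {G : Type*} [Group G] [TopologicalSpace G]
    (hG : ∀ [MulAction G CantorSpace] [ContinuousSMul G CantorSpace],
      HasInvariantProbabilityMeasure G CantorSpace)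
    (Y : Type*) [TopologicalSpace Y] [CompactSpace Y] [T2Space Y] [TotallyDisconnectedSpace Y]
    [SecondCountableTopology Y] [Nonempty Y] [MulAction G Y] [ContinuousSMul G Y] :
    ∃ (μ : Measure CantorSpace) (p : CantorSpace → Y), IsProbabilityMeasure μ ∧ Continuous p ∧
      ∀ (F : Y → ℝ) (g : G), Continuous F → ∫ c, F (g • p c) ∂μ = ∫ c, F (p c) ∂μ := by
  obtain ⟨e⟩ := nonempty_homeomorph_nat_bool (Y × (ℕ → Bool))
  let _ : MulAction G CantorSpace :=
    { smul := fun g c => e (g • (e.symm c).1, (e.symm c).2)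
      one_smul := fun c => by
        change e ((1 : G) • (e.symm c).1, (e.symm c).2) = c
        simp
      mul_smul := fun g h c => by
        change e ((g * h) • (e.symm c).1, (e.symm c).2) =
          e (g • (e.symm (e (h • (e.symm c).1, (e.symm c).2))).1,
            (e.symm (e (h • (e.symm c).1, (e.symm c).2))).2)
        simp [mul_smul] }
  have hsmul : ∀ (g : G) (c : CantorSpace), g • c = e (g • (e.symm c).1, (e.symm c).2) :=
    fun _ _ => rfl
  have : ContinuousSMul G CantorSpace := ⟨by
    simp only [hsmul]
    fun_prop⟩
  obtain ⟨μ, hμ, -, hinv⟩ := hG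
  refine ⟨μ, fun c => (e.symm c).1, hμ, by fun_prop, fun F g hF => ?_⟩
  have := (measurePreserving_smul g μ).integral_comp
    (Homeomorph.smul g : CantorSpace ≃ₜ CantorSpace).measurableEmbedding
    (fun c => F (e.symm c).1)
  simpa [hsmul] using this

/-! ### Hulls of finite-valued functions on a group -/

/-- The hull of `a : G → κ`: the closure of the set of right translates `h ↦ a (h * g)` in the
topology of pointwise convergence. -/
def TranslateHull {G κ : Type*} [Group G] [TopologicalSpace κ] (a : G → κ) : Type _ :=
  ↥(closure (range fun g h : G => a (h * g)))

namespace TranslateHull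

variable {G κ : Type*} [Group G] [TopologicalSpace κ] {a : G → κ}

instance : TopologicalSpace (TranslateHull a) :=
  inferInstanceAs (TopologicalSpace ↥(closure _))

instance : CoeFun (TranslateHull a) fun _ => G → κ := ⟨Subtype.val⟩

lemma continuous_eval (h : G) : Continuous fun y : TranslateHull a => y h :=
  (continuous_apply h).comp continuous_subtype_val

instance : Nonempty (TranslateHull a) := ⟨⟨_, subset_closure (mem_range_self 1)⟩⟩

instance [CompactSpace κ] : CompactSpace (TranslateHull a) :=
  isCompact_iff_compactSpace.1 isClosed_closure.isCompact

/-- `G` acts on the hull by right translation of functions. -/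
instance : MulAction G (TranslateHull a) where
  smul g y := ⟨fun h => y (h * g), by
    refine map_mem_closure (f := fun (z : G → κ) h => z (h * g))
      (continuous_pi fun h => continuous_apply _) y.2 ?_
    rintro _ ⟨g', rfl⟩
    exact ⟨g * g', by simp [mul_assoc]⟩⟩
  one_smul y := Subtype.ext (funext fun h => congrArg y (mul_one h))
  mul_smul g g' y := Subtype.ext (funext fun h => congrArg y (mul_assoc h g g').symm)

lemma smul_apply (g : G) (y : TranslateHull a) (h : G) : (g • y) h = y (h * g) := rfl

variable [DiscreteTopology κ]

/-- On finitely many coordinates, a point of the hull agrees with a translate of `a`; two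
coordinates are enough here. -/
lemma exists_translate (y : TranslateHull a) (h₁ h₂ : G) :
    ∃ g, y h₁ = a (h₁ * g) ∧ y h₂ = a (h₂ * g) := by
  have ho : IsOpen {z : G → κ | z h₁ = y h₁ ∧ z h₂ = y h₂} :=
    ((isOpen_discrete {y h₁}).preimage
      (continuous_apply (A := fun _ : G => κ) h₁)).inter
      ((isOpen_discrete {y h₂}).preimage
        (continuous_apply (A := fun _ : G => κ) h₂))
  obtain ⟨_, ⟨h1, h2⟩, g, rfl⟩ := mem_closure_iff.1 y.2 _ ho ⟨rfl, rfl⟩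
  exact ⟨g, h1.symm, h2.symm⟩

variable {V : Subgroup G}

lemma apply_mul_left (ha : ∀ v ∈ V, ∀ g, a (v * g) = a g) (y : TranslateHull a) {v : G}
    (hv : v ∈ V) (h : G) : y (v * h) = y h := by
  obtain ⟨g, h1, h2⟩ := exists_translate y (v * h) h
  rw [h1, h2, mul_assoc, ha v hv]

variable [TopologicalSpace G] [IsTopologicalGroup G]

lemma continuous_coe (hV : IsOpen (V : Set G)) (ha : ∀ v ∈ V, ∀ g, a (v * g) = a g)
    (y : TranslateHull a) : Continuous y := by
  refine IsLocallyConstant.continuous ((IsLocallyConstant.iff_eventually_eq _).2 fun h => ?_)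
  have hm : (fun h' => h' * h⁻¹) ⁻¹' (V : Set G) ∈ 𝓝 h :=
    (hV.preimage (continuous_mul_const h⁻¹)).mem_nhds (by simp [V.one_mem])
  filter_upwards [hm] with h' hh'
  simpa using apply_mul_left ha y hh' h

lemma continuousSMul (hV : IsOpen (V : Set G)) (ha : ∀ v ∈ V, ∀ g, a (v * g) = a g) :
    ContinuousSMul G (TranslateHull a) := by
  refine ⟨Continuous.subtype_mk (continuous_pi fun h => ?_) _⟩
  refine IsLocallyConstant.continuous ((IsLocallyConstant.iff_eventually_eq _).2 ?_)
  rintro ⟨g, y⟩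
  have hg : (fun g' => h * g' * (h * g)⁻¹) ⁻¹' (V : Set G) ∈ 𝓝 g :=
    (hV.preimage (by fun_prop)).mem_nhds (by simp [V.one_mem])
  have hy : (fun z : TranslateHull a => z (h * g)) ⁻¹' {y (h * g)} ∈ 𝓝 y :=
    ((isOpen_discrete _).preimage (continuous_eval _)).mem_nhds rfl
  filter_upwards [prod_mem_nhds hg hy] with z hz
  have h1 := apply_mul_left ha z.2 hz.1 (h * g)
  rw [inv_mul_cancel_right] at h1
  exact h1.trans hz.2

/-- Restriction to a countable dense subset of `G` embeds the hull into a countable product of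
discrete spaces. -/
lemma exists_isEmbedding [TopologicalSpace.SeparableSpace G] [CompactSpace κ]
    (hV : IsOpen (V : Set G)) (ha : ∀ v ∈ V, ∀ g, a (v * g) = a g) :
    ∃ f : TranslateHull a → ℕ → κ, IsEmbedding f := by
  refine ⟨fun y n => y (TopologicalSpace.denseSeq G n), IsClosedEmbedding.isEmbedding <|
    Continuous.isClosedEmbedding (continuous_pi fun n => continuous_eval _) fun y z hyz => ?_⟩
  exact Subtype.ext <| (TopologicalSpace.denseRange_denseSeq G).equalizer
    (continuous_coe hV ha y) (continuous_coe hV ha z) hyz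

end TranslateHull

/-! ### Almost invariant measures on a compact `G`-space -/

open scoped Uniformity in
/-- For every entourage `U` of a compact `G`-space `X` there are identically distributed `X`-valued
random variables `p · g`, for `g : G`, such that for each `c` and `g` the points `p c 1` and `p c g`
are `U`-close to points `z` and `g • z` of the orbit of `x₀`. By uniform continuity of translation,
`g • p c 1` and `p c g` are then close too, so the distribution of `p · 1` is almost invariant.

The maps `p c : G → X` are points of the hull of a function `a` which approximates `g ↦ g • x₀`
within `U`, takes finitely many values, and is constant on the right cosets of an open subgroup. -/
lemma exists_identically_distributed_near_orbit {G : Type*} [Group G] [TopologicalSpace G]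
    [NonarchimedeanGroup G] [TopologicalSpace.SeparableSpace G]
    (hG : ∀ [MulAction G CantorSpace] [ContinuousSMul G CantorSpace],
      HasInvariantProbabilityMeasure G CantorSpace)
    {X : Type*} [UniformSpace X] [CompactSpace X] [T2Space X] [MulAction G X]
    [ContinuousSMul G X] (x₀ : X) {U : Set (X × X)} (hU : U ∈ 𝓤 X) :
    ∃ (μ : Measure CantorSpace) (p : CantorSpace → G → X), IsProbabilityMeasure μ ∧
      (∀ g, Continuous fun c => p c g) ∧
      (∀ (F : X → ℝ) (g : G), Continuous F → ∫ c, F (p c g) ∂μ = ∫ c, F (p c 1) ∂μ) ∧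
      ∀ c g, ∃ h : G, (p c 1, h • x₀) ∈ U ∧ (p c g, (g * h) • x₀) ∈ U := by
  obtain ⟨W, hW, hWsymm, hWU⟩ := comp_symm_mem_uniformity_sets hU
  obtain ⟨V, hV⟩ : ∃ V : OpenSubgroup G, ∀ v ∈ V, ∀ x : X, (v • x, x) ∈ W := by
    have h1 : ∀ᶠ v in 𝓝 (1 : G), ∀ x ∈ (univ : Set X), (v • x, x) ∈ W := by
      refine isCompact_univ.eventually_forall_of_forall_eventually fun x _ => ?_
      have hc : Continuous fun z : G × X => (z.1 • z.2, z.2) := by fun_prop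
      refine hc.continuousAt.eventually_mem ?_
      simpa using nhds_le_uniformity x hW
    obtain ⟨V, hV⟩ := NonarchimedeanGroup.is_nonarchimedean _ h1
    exact ⟨V, fun v hv x => hV hv x trivial⟩
  obtain ⟨t, ht, hcover⟩ := isCompact_univ.totallyBounded W hW
  have hnet : ∀ x : X, ∃ y : t, (x, (y : X)) ∈ W := fun x => by
    simpa using hcover (mem_univ x)
  choose n hn using hnet
  have : Finite t := ht
  -- A representative of the coset of `g` modulo `V`.
  let ρ : G → G := fun g => (Quotient.mk (QuotientGroup.rightRel V.toSubgroup) g).out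
  have hρ : ∀ g, ρ g * g⁻¹ ∈ V := fun g =>
    QuotientGroup.rightRel_apply.1 (Setoid.symm' (QuotientGroup.rightRel V.toSubgroup)
      (Quotient.mk_out (s := QuotientGroup.rightRel V.toSubgroup) g))
  have hρV : ∀ v ∈ V.toSubgroup, ∀ g, ρ (v * g) = ρ g := fun v hv g => by
    refine congrArg Quotient.out (Quotient.sound ?_)
    refine QuotientGroup.rightRel_apply.2 ?_
    simpa using hv
  let a : G → t := fun g => n (ρ g • x₀)
  have haV : ∀ v ∈ V.toSubgroup, ∀ g, a (v * g) = a g := fun v hv g => by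
    simp only [a, hρV v hv g]
  have ha : ∀ g, ((a g : X), g • x₀) ∈ U := fun g => by
    refine hWU ⟨ρ g • x₀, hWsymm.symm _ _ (hn _), ?_⟩
    simpa [smul_smul] using hV _ (hρ g) (g • x₀)
  have hVo : IsOpen (V.toSubgroup : Set G) := V.isOpen
  obtain ⟨f, hf⟩ := TranslateHull.exists_isEmbedding hVo haV
  have := TranslateHull.continuousSMul hVo haV
  have : T2Space (TranslateHull a) := hf.t2Space
  have : SecondCountableTopology (TranslateHull a) := hf.secondCountableTopology
  have : TotallyDisconnectedSpace (TranslateHull a) :=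
    ⟨hf.isTotallyDisconnected (isTotallyDisconnected_of_totallyDisconnectedSpace _)⟩
  obtain ⟨μ, p, hμ, hp, hinv⟩ := exists_invariant_image_of_cantor hG (TranslateHull a)
  refine ⟨μ, fun c g => p c g, hμ, fun g => continuous_subtype_val.comp
    ((TranslateHull.continuous_eval g).comp hp), fun F g hF => ?_, fun c g => ?_⟩
  · have := hinv (fun y => F (y 1)) g
      (hF.comp (continuous_subtype_val.comp (TranslateHull.continuous_eval 1)))
    simpa [TranslateHull.smul_apply] using this
  · obtain ⟨h, h1, h2⟩ := TranslateHull.exists_translate (p c) 1 g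
    refine ⟨h, ?_, ?_⟩
    · simpa [h1] using ha h
    · simpa [h2] using ha (g * h)

/-! ### Passing to the limit -/

open scoped CompactlySupported in
/-- A net of probability measures which is asymptotically invariant on continuous functions yields
an invariant measure, namely the one that represents an ultrafilter limit of the integration
functionals. -/
lemma hasInvariantProbabilityMeasure_of_approx {G X ι : Type*} [Group G] [TopologicalSpace X]
    [CompactSpace X] [T2Space X] [MeasurableSpace X] [BorelSpace X] [MulAction G X]
    [ContinuousConstSMul G X] (l : Filter ι) [l.NeBot] (ν : ι → Measure X)
    [∀ i, IsProbabilityMeasure (ν i)]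
    (h : ∀ (f : C(X, ℝ)) (g : G), Tendsto (fun i => ∫ x, f (g • x) ∂ν i - ∫ x, f x ∂ν i) l (𝓝 0)) :
    HasInvariantProbabilityMeasure G X := by
  have hint : ∀ i (f : C(X, ℝ)), Integrable f (ν i) := fun i f =>
    f.continuous.integrable_of_hasCompactSupport (HasCompactSupport.of_compactSpace f)
  let 𝒰 : Ultrafilter ι := Ultrafilter.of l
  have h𝒰 : (𝒰 : Filter ι) ≤ l := Ultrafilter.of_le l
  have hlim : ∀ f : C(X, ℝ), ∃ L, Tendsto (fun i => ∫ x, f x ∂ν i) 𝒰 (𝓝 L) := fun f => by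
    have hb : ∀ i, ∫ x, f x ∂ν i ∈ Metric.closedBall (0 : ℝ) ‖f‖ := fun i => by
      rw [mem_closedBall_zero_iff]
      simpa using norm_integral_le_of_norm_le_const (μ := ν i)
        (Eventually.of_forall fun x => f.norm_coe_le_norm x)
    obtain ⟨L, -, hL⟩ := (isCompact_closedBall (0 : ℝ) ‖f‖).ultrafilter_le_nhds
      (𝒰.map fun i => ∫ x, f x ∂ν i)
      (le_principal_iff.2 (Eventually.of_forall (f := (𝒰 : Filter ι)) hb))
    exact ⟨L, hL⟩
  choose L hL using hlim
  let Λ : C_c(X, ℝ) →ₚ[ℝ] ℝ := PositiveLinearMap.mk₀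
    { toFun := fun f => L f.toContinuousMap
      map_add' := fun f f' => by
        refine tendsto_nhds_unique (hL _) (((hL _).add (hL _)).congr fun i => ?_)
        exact (integral_add (hint i f.toContinuousMap) (hint i f'.toContinuousMap)).symm
      map_smul' := fun r f => by
        refine tendsto_nhds_unique (hL _) (((hL f.toContinuousMap).const_mul r).congr fun i => ?_)
        exact (integral_const_mul r _).symm }
    (fun f hf => ge_of_tendsto' (hL _) fun i => integral_nonneg hf)
  have hΛ : ∀ f : C(X, ℝ), ∫ x, f x ∂(RealRMK.rieszMeasure Λ) = L f := fun f =>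
    RealRMK.integral_rieszMeasure Λ ⟨f, HasCompactSupport.of_compactSpace f⟩
  refine ⟨RealRMK.rieszMeasure Λ, ⟨?_⟩, inferInstance, ⟨fun g s hs => ?_⟩⟩
  · have h1 : L 1 = 1 := tendsto_nhds_unique (hL 1) (by simp)
    have h2 := hΛ 1
    rw [h1] at h2
    simp only [ContinuousMap.one_apply, integral_const, smul_eq_mul, mul_one] at h2
    rwa [measureReal_def, ENNReal.toReal_eq_one_iff] at h2
  · have hreg : (Measure.map (g • ·) (RealRMK.rieszMeasure Λ)).Regular :=
      Measure.Regular.map (Homeomorph.smul g)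
    have hmap : Measure.map (g • ·) (RealRMK.rieszMeasure Λ) = RealRMK.rieszMeasure Λ := by
      refine Measure.ext_of_integral_eq_on_compactlySupported fun f => ?_
      refine (integral_map (measurable_const_smul g).aemeasurable
        f.continuous.aestronglyMeasurable).trans ?_
      let f' : C(X, ℝ) := ⟨fun x => f (g • x), by fun_prop⟩
      refine (hΛ f').trans (Eq.trans ?_ (hΛ f.toContinuousMap).symm)
      have h3 := (hL f').sub (hL f.toContinuousMap)
      exact sub_eq_zero.1 (tendsto_nhds_unique h3 ((h f.toContinuousMap g).mono_left h𝒰))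
    conv_rhs => rw [← hmap]
    rw [Measure.map_apply (measurable_const_smul g) hs]

/-! ### Amenability is tested on the Cantor space -/

/-- A separable non-archimedean group all of whose continuous actions on the Cantor space have
invariant measures is amenable. -/
theorem isAmenable_of_cantor {G : Type u} [Group G] [TopologicalSpace G]
    [NonarchimedeanGroup G] [TopologicalSpace.SeparableSpace G]
    (hG : ∀ [MulAction G CantorSpace] [ContinuousSMul G CantorSpace],
      HasInvariantProbabilityMeasure G CantorSpace) :
    IsAmenableTopologicalGroup.{u, v} G := by
  intro X _ _ _ hX _ _ _ _
  let _ : UniformSpace X := uniformSpaceOfCompactR1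
  obtain ⟨x₀⟩ := hX
  have key := fun U : {U : Set (X × X) // U ∈ uniformity X} =>
    exists_identically_distributed_near_orbit hG x₀ U.2
  choose μ p hμ hp hdist hnear using key
  let l : Filter {U : Set (X × X) // U ∈ uniformity X} :=
    comap Subtype.val (uniformity X).smallSets
  have hl : l.NeBot := by
    refine comap_neBot fun T hT => ?_
    obtain ⟨U, hU, hUT⟩ := eventually_smallSets.1 hT
    exact ⟨⟨U, hU⟩, hUT U Subset.rfl⟩
  have hmeas : ∀ U g, Measurable fun c => p U c g := fun U g => (hp U g).measurable
  have hprob : ∀ U, IsProbabilityMeasure ((μ U).map fun c => p U c 1) := fun U =>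
    have := hμ U
    Measure.isProbabilityMeasure_map (hmeas U 1).aemeasurable
  refine hasInvariantProbabilityMeasure_of_approx l (fun U => (μ U).map fun c => p U c 1)
    fun f g => ?_
  have hf : UniformContinuous f := CompactSpace.uniformContinuous_of_continuous f.continuous
  have hfg : UniformContinuous fun x => f (g • x) :=
    CompactSpace.uniformContinuous_of_continuous (by fun_prop)
  rw [Metric.tendsto_nhds]
  intro ε hε
  have hW : {z : X × X | dist (f z.1) (f z.2) < ε / 4} ∩
      {z : X × X | dist (f (g • z.1)) (f (g • z.2)) < ε / 4} ∈ uniformity X :=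
    inter_mem (hf (Metric.dist_mem_uniformity (by positivity)))
      (hfg (Metric.dist_mem_uniformity (by positivity)))
  refine eventually_comap.2 (eventually_smallSets.2 ⟨_, hW, ?_⟩)
  rintro _ hUW U rfl
  have := hμ U
  have hclose : ∀ c, ‖f (g • p U c 1) - f (p U c g)‖ ≤ ε / 2 := fun c => by
    obtain ⟨h, h1, h2⟩ := hnear U c g
    have h3 := (hUW h1).2
    have h4 := (hUW h2).1
    simp only [mem_ofPred_eq, smul_smul] at h3 h4
    rw [← dist_eq_norm]
    linarith [dist_triangle_right (f (g • p U c 1)) (f (p U c g)) (f ((g * h) • x₀))]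
  have hint : ∀ F : CantorSpace → ℝ, Continuous F → Integrable F (μ U) := fun F hF =>
    hF.integrable_of_hasCompactSupport (HasCompactSupport.of_compactSpace F)
  rw [integral_map (hmeas U 1).aemeasurable hfg.continuous.aestronglyMeasurable,
    integral_map (hmeas U 1).aemeasurable (by fun_prop), ← hdist U f g f.continuous,
    ← integral_sub (hint _ (by fun_prop)) (hint _ (by fun_prop)), dist_zero_right]
  calc _ ≤ ε / 2 * (μ U).real univ :=
        norm_integral_le_of_norm_le_const (Eventually.of_forall hclose)
    _ < ε := by simp; linarith

theorem mainTheorem2 (G : Type u) [Group G] [TopologicalSpace G] [PolishSpace G]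
    [NonarchimedeanGroup G] :
    IsAmenableTopologicalGroup.{u, v} G ↔
      ∀ [MulAction G CantorSpace] [ContinuousSMul G CantorSpace],
        HasInvariantProbabilityMeasure G CantorSpace := by
  refine ⟨fun hG _ _ => ?_, fun hG => isAmenable_of_cantor hG⟩
  -- The Cantor space is lifted to the universe in which amenability is tested.
  have hsmul : ∀ (g : G) (x : ULift.{v} CantorSpace), g • x = ULift.up (g • x.down) := fun _ _ => rfl
  have : ContinuousSMul G (ULift.{v} CantorSpace) := ⟨by
    simp only [hsmul]
    fun_prop⟩
  obtain ⟨μ, hμ, hreg, hinv⟩ := hG (ULift.{v} CantorSpace)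
  have hd : Measurable (ULift.down : ULift.{v} CantorSpace → CantorSpace) := measurable_down
  refine ⟨μ.map ULift.down, Measure.isProbabilityMeasure_map hd.aemeasurable,
    Measure.Regular.map Homeomorph.ulift, ⟨fun g s hs => ?_⟩⟩
  rw [Measure.map_apply hd hs, Measure.map_apply hd (measurable_const_smul g hs)]
  exact hinv.measure_preimage_smul g (hd hs)
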